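/- Let $n\ge 1$ and $d,p,q\ge 0$ be integers. For $d$-mode tensors $\mathcal S=[s_{i_1,\ldots,i_d}]$, $\mathcal T=[t_{i_1,\ldots,i_d}]\in\otimes^d\mathbb R^n$ put $$\langle \mathcal S,\mathcal T\rangle=\sum_{i_1,\ldots,i_d\in[n]}s_{i_1,\ldots,i_d}t_{i_1,\ldots,i_d},\quad \|\mathcal T\|_{HS}=\sqrt{\langle \mathcal T,\mathcal T\rangle},\quad \|\mathcal T\|_\sigma=\max\{|\langle \mathcal T,x_1\otimes\cdots\otimes x_d\rangle| : x_j\in\mathbb R^n,\ \|x_j\|_2=1,\ j\in[d]\}.$$ Let $\mathrm S^d\mathbb R^n\subset\otimes^d\mathbb R^n$ be the subspace of symmetric tensors, and let $\mathrm{sym}(\mathcal T)$ be the symmetric tensor with entries $\frac1{d!}\sum_{\pi}t_{i_{\pi(1)},\ldots,i_{\pi(d)}}$, where $\pi$ runs over the permutations of $[d]$. The tensor product $\mathcal F\otimes\mathcal G$ has entries $f_{i_1,\ldots,i_p}g_{j_1,\ldots,j_q}$. For every real homogeneous polynomial $f$ of degree $p$ in $n$ variables (the zero polynomial included) there is a unique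 $\mathcal F\in\mathrm S^p\mathbb R^n$ with $f(x)=\langle\mathcal F,\otimes^p x\rangle$ for all $x\in\mathbb R^n$; define $\|f\|_{HS}=\|\mathcal F\|_{HS}$ and $\|f\|_\sigma=\|\mathcal F\|_\sigma$. For $\mathcal F\in\mathrm S^p\mathbb R^n$ and $\mathcal G\in\mathrm S^q\mathbb R^n$ let $\mathcal F\underset{\rm sym}{\otimes}\mathcal G$ be the unique symmetric tensor $\mathcal H\in\mathrm S^{p+q}\mathbb R^n$ with $\langle\mathcal H,\otimes^{p+q}x\rangle=\langle\mathcal F,\otimes^p x\rangle\langle\mathcal G,\otimes^q x\rangle$ for all $x\in\mathbb R^n$. **Lemma.** Let $\mathcal T\in\otimes^d\mathbb R^n$, $\mathcal F\in\mathrm S^p\mathbb R^n$ and $\mathcal G\in\mathrm S^q\mathbb R^n$. Then: (a) $\|\mathrm{sym}(\mathcal T)\|_{HS}\le\|\mathcal T\|_{HS}$. Equality holds if and only if $\mathrm{sym}(\mathcal T)=\mathcal T$. (b) $\langle\mathcal T,\otimes^d x\rangle=\langle\mathrm{sym}(\mathcal T),\otimes^d x\rangle$ for all $x\in\mathbb R^n$.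 (c) $\|\mathrm{sym}(\mathcal T)\|_\sigma\le\|\mathcal T\|_\sigma$. Equality holds if and only if there exists $x\in\mathbb R^n$, $\|x\|_2=1$, such that $\|\mathcal T\|_\sigma=|\langle\mathcal T,\otimes^d x\rangle|$. (d) $\mathcal F\underset{\rm sym}{\otimes}\mathcal G=\mathrm{sym}(\mathcal F\otimes\mathcal G)$. (e) $\|\mathcal F\underset{\rm sym}{\otimes}\mathcal G\|_{HS}\le\|\mathcal F\|_{HS}\|\mathcal G\|_{HS}$. If $p,q\ge1$, equality holds if and only if $\mathcal F=0$, or $\mathcal G=0$, or $\mathcal F=a\otimes^p c$ and $\mathcal G=b\otimes^q c$ for some $c\in\mathbb R^n\setminus\{0\}$ and $a,b\in\mathbb R\setminus\{0\}$. (f) Let $f$ and $g$ be real homogeneous polynomials in $n$ variables of degrees $p$ and $q$. Then: (i) $|f(c)|\le\|f\|_{HS}\|c\|_2^p$ for all $c\in\mathbb R^n$. For $c\ne0$ equality holds if and only if there exists $a\in\mathbb R$ such that $f(x)=a(c^\top x)^p$ for all $x\in\mathbb R^n$. (ii) $\|fg\|_{HS}\le\|f\|_{HS}\|g\|_{HS}$.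 If $p,q\ge1$, equality holds if and only if $f=0$, or $g=0$, or there exist $c\in\mathbb R^n\setminus\{0\}$ and $a,b\in\mathbb R\setminus\{0\}$ such that $f(x)=a(c^\top x)^p$ and $g(x)=b(c^\top x)^q$ for all $x\in\mathbb R^n$. (iii) $\|fg\|_\sigma\le\|f\|_\sigma\|g\|_\sigma$. Equality holds if and only if there exists $x\in\mathbb R^n$, $\|x\|_2=1$, such that $\|f\|_\sigma=|f(x)|$ and $\|g\|_\sigma=|g(x)|$. (iv) $\|f^k\|_\sigma=\|f\|_\sigma^k$ for every integer $k\ge1$. -/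

import Mathlib

noncomputable section

namespace SymTensor

/-- The space `⊗^d ℝⁿ` of `d`-mode tensors, given by their entries `t_{i_1,…,i_d}`. -/
abbrev Tensor (d n : ℕ) : Type := (Fin d → Fin n) → ℝ

/-- The inner product `⟨S, T⟩ = ∑ s_{i_1,…,i_d} t_{i_1,…,i_d}`. -/
def innerT {d n : ℕ} (S T : Tensor d n) : ℝ := ∑ i, S i * T i

/-- The Hilbert-Schmidt norm `‖T‖_HS = √⟨T, T⟩`. -/
def hsNorm {d n : ℕ} (T : Tensor d n) : ℝ := Real.sqrt (innerT T T)

/-- The rank one tensor `x_1 ⊗ ⋯ ⊗ x_d`. -/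
def rankOne {d n : ℕ} (x : Fin d → EuclideanSpace ℝ (Fin n)) : Tensor d n :=
  fun i => ∏ j, x j (i j)

/-- The power `⊗^d x`. -/
def tpow {n : ℕ} (d : ℕ) (x : EuclideanSpace ℝ (Fin n)) : Tensor d n :=
  rankOne fun _ => x

/-- The values `|⟨T, x_1 ⊗ ⋯ ⊗ x_d⟩|` over unit vectors `x_1, …, x_d`. -/
def specSet {d n : ℕ} (T : Tensor d n) : Set ℝ :=
  {r | ∃ x : Fin d → EuclideanSpace ℝ (Fin n), (∀ j, ‖x j‖ = 1) ∧ r = |innerT T (rankOne x)|}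

/-- The spectral norm `‖T‖_σ`: the maximum of `|⟨T, x_1 ⊗ ⋯ ⊗ x_d⟩|` over unit vectors. That the
supremum is a maximum for `1 ≤ n` is `isGreatest_specNorm` below. -/
def specNorm {d n : ℕ} (T : Tensor d n) : ℝ := sSup (specSet T)

/-- Symmetric tensors, the elements of `S^d ℝⁿ`. -/
def IsSymm {d n : ℕ} (T : Tensor d n) : Prop :=
  ∀ (σ : Equiv.Perm (Fin d)) (i : Fin d → Fin n), T (i ∘ σ) = T i

/-- The symmetrization: `s_{i_1,…,i_d} = (1/d!) ∑_σ t_{i_{σ(1)},…,i_{σ(d)}}`. -/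
def sym {d n : ℕ} (T : Tensor d n) : Tensor d n :=
  fun i => (1 / (d.factorial : ℝ)) * ∑ σ : Equiv.Perm (Fin d), T (i ∘ σ)

/-- The tensor (Kronecker) product, with entries `a_{i_1,…,i_p} b_{j_1,…,j_q}`. -/
def kron {p q n : ℕ} (A : Tensor p n) (B : Tensor q n) : Tensor (p + q) n :=
  fun i => A (fun j => i (Fin.castAdd q j)) * B (fun j => i (Fin.natAdd p j))

/-- The homogeneous polynomial `f(x) = ⟨F, ⊗^p x⟩ = ∑ f_{i_1,…,i_p} x_{i_1} ⋯ x_{i_p}`. -/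
def form {p n : ℕ} (F : Tensor p n) : MvPolynomial (Fin n) ℝ :=
  ∑ i, MvPolynomial.C (F i) * ∏ j, MvPolynomial.X (i j)

/-- The exponent vector `(j_1,…,j_n)` of `x_{i_1} ⋯ x_{i_p}`: `j_k` is the number of times that `k`
appears in `i_1,…,i_p`. -/
def expo {p n : ℕ} (i : Fin p → Fin n) : Fin n →₀ ℕ := ∑ j, Finsupp.single (i j) 1

/-- The symmetric `p`-tensor of a homogeneous polynomial `f` of degree `p`: its entry at
`i_1,…,i_p` is `φ_{j_1,…,j_n}`, where `(p! / (j_1! ⋯ j_n!)) φ_{j_1,…,j_n}` is the coefficient of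
`x_1^{j_1} ⋯ x_n^{j_n}` in `f` and `j_k` is the number of times that `k` appears in `i_1,…,i_p`.
It is the unique symmetric tensor `F` with `form F = f`: see `isSymm_tensorOf`, `form_tensorOf`
and `tensorOf_form` below. -/
def tensorOf {n : ℕ} (p : ℕ) (f : MvPolynomial (Fin n) ℝ) : Tensor p n :=
  fun i => MvPolynomial.coeff (expo i) f / ((expo i).multinomial : ℝ)

/-- `‖f‖_HS` for a homogeneous polynomial `f` of degree `p`. -/
def polyHS {n : ℕ} (p : ℕ) (f : MvPolynomial (Fin n) ℝ) : ℝ := hsNorm (tensorOf p f)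

/-- `‖f‖_σ` for a homogeneous polynomial `f` of degree `p`. -/
def polySpec {n : ℕ} (p : ℕ) (f : MvPolynomial (Fin n) ℝ) : ℝ := specNorm (tensorOf p f)

/-- The symmetric product of `F ∈ S^p ℝⁿ` and `G ∈ S^q ℝⁿ`: the symmetric `(p+q)`-tensor `H` with
`⟨H, ⊗^{p+q} x⟩ = f(x) g(x)`, where `f(x) = ⟨F, ⊗^p x⟩` and `g(x) = ⟨G, ⊗^q x⟩`. -/
def symProd {p q n : ℕ} (F : Tensor p n) (G : Tensor q n) : Tensor (p + q) n :=
  tensorOf (p + q) (form F * form G)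

/-! The facts that show that the definitions above are the intended ones. -/

theorem isGreatest_specNorm {d n : ℕ} (hn : 1 ≤ n) (T : Tensor d n) :
    IsGreatest (specSet T) (specNorm T) := by
  have hK : IsCompact (Set.univ.pi fun _ : Fin d =>
      Metric.sphere (0 : EuclideanSpace ℝ (Fin n)) 1) :=
    isCompact_univ_pi fun _ => isCompact_sphere _ _
  have hcont : Continuous fun x : Fin d → EuclideanSpace ℝ (Fin n) =>
      |innerT T (rankOne x)| := by
    unfold innerT rankOne
    fun_prop
  have hset : specSet T = (fun x : Fin d → EuclideanSpace ℝ (Fin n) =>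
      |innerT T (rankOne x)|) '' (Set.univ.pi fun _ : Fin d =>
      Metric.sphere (0 : EuclideanSpace ℝ (Fin n)) 1) := by
    ext r
    simp [specSet, eq_comm]
  have hne : (specSet T).Nonempty :=
    ⟨_, fun _ => EuclideanSpace.single (⟨0, hn⟩ : Fin n) (1 : ℝ), by simp, rfl⟩
  have hc : IsCompact (specSet T) := hset ▸ hK.image hcont
  exact hc.isGreatest_sSup hne

theorem eval_form {p n : ℕ} (F : Tensor p n) (x : EuclideanSpace ℝ (Fin n)) :
    MvPolynomial.eval (fun k => x k) (form F) = innerT F (tpow p x) := by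
  simp [form, innerT, tpow, rankOne, map_sum, map_prod]

theorem prod_X_eq {p n : ℕ} (i : Fin p → Fin n) :
    (∏ j, MvPolynomial.X (i j) : MvPolynomial (Fin n) ℝ) = MvPolynomial.monomial (expo i) 1 := by
  simp [expo, MvPolynomial.monomial_sum_one, MvPolynomial.X]

theorem form_isHomogeneous {p n : ℕ} (F : Tensor p n) : (form F).IsHomogeneous p := by
  refine MvPolynomial.IsHomogeneous.sum _ _ _ fun i _ => ?_
  have h := (MvPolynomial.isHomogeneous_C (Fin n) (F i)).mul
    (MvPolynomial.IsHomogeneous.prod Finset.univ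
      (fun j => (MvPolynomial.X (i j) : MvPolynomial (Fin n) ℝ)) (fun _ => 1)
      (fun j _ => MvPolynomial.isHomogeneous_X ℝ (i j)))
  simpa using h

theorem coeff_form {p n : ℕ} (F : Tensor p n) (m : Fin n →₀ ℕ) :
    MvPolynomial.coeff m (form F) = ∑ i with expo i = m, F i := by
  simp [form, prod_X_eq, MvPolynomial.coeff_sum, MvPolynomial.coeff_C_mul,
    MvPolynomial.coeff_monomial, Finset.sum_filter]

theorem expo_apply {p n : ℕ} (i : Fin p → Fin n) (k : Fin n) :
    expo i k = Fintype.card {j // i j = k} := by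
  simp [expo, Finsupp.finsetSum_apply, Finsupp.single_apply, Fintype.card_subtype]

theorem expo_comp {p n : ℕ} (i : Fin p → Fin n) (σ : Equiv.Perm (Fin p)) :
    expo (i ∘ σ) = expo i :=
  Equiv.sum_comp σ fun j => Finsupp.single (i j) 1

theorem exists_perm {p n : ℕ} {i i' : Fin p → Fin n} (h : expo i = expo i') :
    ∃ σ : Equiv.Perm (Fin p), i' ∘ σ = i := by
  have e : ∀ k, Nonempty ({j // i j = k} ≃ {j // i' j = k}) := fun k =>
    ⟨Fintype.equivOfCardEq (by rw [← expo_apply, ← expo_apply, h])⟩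
  exact ⟨Equiv.ofFiberEquiv fun k => (e k).some,
    funext fun j => Equiv.ofFiberEquiv_map (fun k => (e k).some) j⟩

theorem card_expo {p n : ℕ} (i : Fin p → Fin n) :
    ((Finset.univ.filter fun i' : Fin p → Fin n => expo i' = expo i).card : ℝ)
      = (expo i).multinomial := by
  have h1 := coeff_form (fun _ : Fin p → Fin n => (1 : ℝ)) (expo i)
  have h2 : form (fun _ : Fin p → Fin n => (1 : ℝ)) =
      ((Finsupp.equivFunOnFinite.symm fun _ : Fin n => (1 : ℝ)).linearCombination ℝ
        (MvPolynomial.X : Fin n → MvPolynomial (Fin n) ℝ)) ^ p := by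
    rw [Finsupp.linearCombination_apply, Finsupp.sum_fintype _ _ (by simp)]
    simp [form, Fintype.sum_pow]
  have h3 : (expo i).sum (fun _ m => m) = p := by
    rw [Finsupp.sum_fintype _ _ (by simp)]
    simp only [expo, Finsupp.finsetSum_apply]
    rw [Finset.sum_comm]
    simp [Finsupp.single_apply]
  rw [h2, MvPolynomial.coeff_linearCombination_X_pow, if_pos h3] at h1
  simpa using h1.symm

theorem isSymm_tensorOf {n : ℕ} (p : ℕ) (f : MvPolynomial (Fin n) ℝ) :
    IsSymm (tensorOf p f) := fun σ i => by
  simp only [tensorOf, expo_comp]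

theorem tensorOf_form {p n : ℕ} {F : Tensor p n} (hF : IsSymm F) : tensorOf p (form F) = F := by
  funext i
  have h : ∀ i' ∈ Finset.univ.filter (fun i' : Fin p → Fin n => expo i' = expo i),
      F i' = F i := fun i' hi' => by
    obtain ⟨σ, hσ⟩ := exists_perm (Finset.mem_filter.1 hi').2
    rw [← hσ, hF]
  have hpos : ((Finset.univ.filter fun i' : Fin p → Fin n => expo i' = expo i).card : ℝ) ≠ 0 :=
    Nat.cast_ne_zero.2 (Finset.card_ne_zero_of_mem (Finset.mem_filter.2 ⟨Finset.mem_univ i, rfl⟩))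
  rw [tensorOf, coeff_form, Finset.sum_congr rfl h, ← card_expo, Finset.sum_const, nsmul_eq_mul,
    mul_div_cancel_left₀ _ hpos]

theorem exists_expo {p n : ℕ} {m : Fin n →₀ ℕ} (hm : m.degree = p) :
    ∃ i : Fin p → Fin n, expo i = m := by
  have hc : Fintype.card (Fin p) = Fintype.card (Σ k : Fin n, Fin (m k)) := by
    simp [← hm, Finsupp.degree_eq_sum]
  refine ⟨fun j => (Fintype.equivOfCardEq hc j).1, ?_⟩
  rw [expo, (Fintype.equivOfCardEq hc).sum_comp fun s => Finsupp.single s.1 1,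
    Fintype.sum_sigma]
  ext k
  simp

theorem form_tensorOf {p n : ℕ} {f : MvPolynomial (Fin n) ℝ} (hf : f.IsHomogeneous p) :
    form (tensorOf p f) = f := by
  ext m
  rw [coeff_form]
  by_cases hm : m.degree = p
  · obtain ⟨i, rfl⟩ := exists_expo hm
    have hpos : ((expo i).multinomial : ℝ) ≠ 0 := by
      rw [← card_expo]
      exact Nat.cast_ne_zero.2
        (Finset.card_ne_zero_of_mem (Finset.mem_filter.2 ⟨Finset.mem_univ i, rfl⟩))
    rw [Finset.sum_congr rfl (g := fun _ => tensorOf p f i) fun i' hi' => by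
      simp only [tensorOf, (Finset.mem_filter.1 hi').2]]
    rw [Finset.sum_const, nsmul_eq_mul, card_expo, tensorOf, mul_div_cancel₀ _ hpos]
  · rw [hf.coeff_eq_zero hm]
    refine Finset.sum_eq_zero fun i hi => ?_
    simp only [tensorOf, (Finset.mem_filter.1 hi).2, hf.coeff_eq_zero hm, zero_div]

theorem innerT_symProd {p q n : ℕ} (F : Tensor p n) (G : Tensor q n)
    (x : EuclideanSpace ℝ (Fin n)) :
    innerT (symProd F G) (tpow (p + q) x) = innerT F (tpow p x) * innerT G (tpow q x) := by
  rw [symProd, ← eval_form, form_tensorOf ((form_isHomogeneous F).mul (form_isHomogeneous G)),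
    map_mul, eval_form, eval_form]

end SymTensor

end

open SymTensor

namespace SymTensor

variable {d p q n : ℕ}

/-! Symmetrization is the orthogonal projection onto the symmetric tensors, and `⊗^d x` is
symmetric. Pythagoras therefore gives the Hilbert-Schmidt inequality with its equality case, and `T`
and `sym T` have the same values on powers `⊗^d x`.

The spectral statements rest on Banach's theorem (`exists_specNorm_eq_abs_innerT_tpow`): a symmetric
tensor attains its spectral norm at a power `⊗^d x`. Among all maximizing tuples of unit vectors,
take one whose sum has the greatest norm. If two of its entries differed, polarization and the
parallelogram law would allow both to be replaced by one unit vector, up to a common sign, and the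
sum would become longer. So `‖f‖_σ` is the maximum of `|f|` on the unit sphere, which yields the
claims on products and powers.

The symmetric product is `sym (kron F G)` because both tensors are symmetric and define the
polynomial `form F * form G`. As the Hilbert-Schmidt norm is multiplicative on `kron`, equality in
the product inequality means that `kron F G` is itself symmetric. Exchanging an index of `F` with an
index of `G` then forces both factors, when nonzero, to be multiples of powers of one vector
(`IsSymm.exists_eq_smul_tpow`). The bound on `|f(c)|` is Cauchy-Schwarz against `⊗^p c`. -/

theorem innerT_comm (S T : Tensor d n) : innerT S T = innerT T S :=
  Finset.sum_congr rfl fun _ _ => mul_comm _ _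

theorem innerT_sub_left (S S' T : Tensor d n) :
    innerT (S - S') T = innerT S T - innerT S' T := by
  simp [innerT, sub_mul, Finset.sum_sub_distrib]

theorem innerT_smul_left (a : ℝ) (S T : Tensor d n) : innerT (a • S) T = a * innerT S T := by
  simp [innerT, Finset.mul_sum, mul_assoc]

theorem innerT_sub_right (S T T' : Tensor d n) :
    innerT S (T - T') = innerT S T - innerT S T' := by
  simp [innerT, mul_sub, Finset.sum_sub_distrib]

theorem innerT_smul_right (a : ℝ) (S T : Tensor d n) : innerT S (a • T) = a * innerT S T := by
  rw [innerT_comm, innerT_smul_left, innerT_comm]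

theorem innerT_self_nonneg (T : Tensor d n) : 0 ≤ innerT T T :=
  Finset.sum_nonneg fun _ _ => mul_self_nonneg _

theorem innerT_self_eq_zero {T : Tensor d n} : innerT T T = 0 ↔ T = 0 := by
  rw [innerT, Finset.sum_eq_zero_iff_of_nonneg fun _ _ => mul_self_nonneg _]
  simp [funext_iff]

theorem hsNorm_nonneg (T : Tensor d n) : 0 ≤ hsNorm T := Real.sqrt_nonneg _

theorem hsNorm_sq (T : Tensor d n) : hsNorm T ^ 2 = innerT T T :=
  Real.sq_sqrt (innerT_self_nonneg T)

theorem hsNorm_smul (a : ℝ) (T : Tensor d n) : hsNorm (a • T) = |a| * hsNorm T := by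
  rw [hsNorm, innerT_smul_left, innerT_smul_right, ← mul_assoc, Real.sqrt_mul (mul_self_nonneg a),
    Real.sqrt_mul_self_eq_abs, hsNorm]

theorem hsNorm_zero : hsNorm (0 : Tensor d n) = 0 := by simp [hsNorm, innerT]

/-! Symmetrization is the orthogonal projection onto the symmetric tensors. -/

theorem innerT_comp_perm (σ : Equiv.Perm (Fin d)) (S T : Tensor d n) :
    innerT (fun i => S (i ∘ σ)) (fun i => T (i ∘ σ)) = innerT S T :=
  (σ.symm.arrowCongr (Equiv.refl (Fin n))).sum_comp fun i => S i * T i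

theorem isSymm_sym (T : Tensor d n) : IsSymm (sym T) := fun σ i => by
  simp only [sym]
  congr 1
  exact Equiv.sum_comp (Equiv.mulLeft σ) fun τ : Equiv.Perm (Fin d) => T (i ∘ τ)

theorem sym_eq_self {T : Tensor d n} (hT : IsSymm T) : sym T = T := by
  funext i
  have h : (d.factorial : ℝ) ≠ 0 := Nat.cast_ne_zero.2 d.factorial_ne_zero
  simp [sym, hT _ i, Fintype.card_perm, h]

theorem sym_eq_self_iff {T : Tensor d n} : sym T = T ↔ IsSymm T :=
  ⟨fun h => h ▸ isSymm_sym T, sym_eq_self⟩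

theorem innerT_sym (S T : Tensor d n) :
    innerT (sym S) T
      = (1 / (d.factorial : ℝ)) * ∑ σ : Equiv.Perm (Fin d), innerT (fun i => S (i ∘ σ)) T := by
  simp only [innerT, sym, mul_assoc, ← Finset.mul_sum, Finset.sum_mul]
  rw [Finset.sum_comm]

/-- A permutation of the indices preserves the inner product and fixes `T`, so all `d!` terms of the
average contribute the same number. Hence `S - sym S` is orthogonal to every symmetric tensor. -/
theorem innerT_sym_left_of_isSymm (S : Tensor d n) {T : Tensor d n} (hT : IsSymm T) :
    innerT (sym S) T = innerT S T := by
  have h (σ : Equiv.Perm (Fin d)) : innerT (fun i => S (i ∘ σ)) T = innerT S T := by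
    rw [← innerT_comp_perm σ S T]
    simp only [hT σ]
  have h0 : (d.factorial : ℝ) ≠ 0 := Nat.cast_ne_zero.2 d.factorial_ne_zero
  simp [innerT_sym, h, Fintype.card_perm, h0]

/-- Pythagoras: `sym T` is symmetric, hence orthogonal to `T - sym T`. -/
theorem hsNorm_sq_eq_add (T : Tensor d n) :
    hsNorm T ^ 2 = hsNorm (sym T) ^ 2 + innerT (T - sym T) (T - sym T) := by
  have h := innerT_sym_left_of_isSymm T (isSymm_sym T)
  rw [hsNorm_sq, hsNorm_sq, innerT_sub_left, innerT_sub_right, innerT_sub_right,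
    innerT_comm (sym T) T]
  linarith

theorem hsNorm_sym_le (T : Tensor d n) : hsNorm (sym T) ≤ hsNorm T :=
  le_of_sq_le_sq (by linarith [hsNorm_sq_eq_add T, innerT_self_nonneg (T - sym T)])
    (hsNorm_nonneg T)

theorem hsNorm_sym_eq_iff (T : Tensor d n) : hsNorm (sym T) = hsNorm T ↔ sym T = T := by
  refine ⟨fun h => ?_, fun h => by rw [h]⟩
  have h1 := hsNorm_sq_eq_add T
  rw [h] at h1
  exact (sub_eq_zero.1 (innerT_self_eq_zero.1 (by linarith))).symm

theorem isSymm_tpow (x : EuclideanSpace ℝ (Fin n)) : IsSymm (tpow d x) := fun σ i =>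
  Equiv.prod_comp σ fun j => x (i j)

theorem IsSymm.smul {T : Tensor d n} (hT : IsSymm T) (a : ℝ) : IsSymm (a • T) := fun σ i => by
  simp [hT σ i]

theorem innerT_sym_tpow (T : Tensor d n) (x : EuclideanSpace ℝ (Fin n)) :
    innerT (sym T) (tpow d x) = innerT T (tpow d x) :=
  innerT_sym_left_of_isSymm T (isSymm_tpow x)

/-! The multilinear form of a tensor and its maxima. -/

/-- The multilinear form `(x_1, …, x_d) ↦ ⟨T, x_1 ⊗ ⋯ ⊗ x_d⟩`. -/
noncomputable def toMultilinear (T : Tensor d n) :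
    MultilinearMap ℝ (fun _ : Fin d => EuclideanSpace ℝ (Fin n)) ℝ :=
  ∑ i, T i • (MultilinearMap.mkPiAlgebra ℝ (Fin d) ℝ).compLinearMap
    fun j => (EuclideanSpace.proj (𝕜 := ℝ) (i j)).toLinearMap

theorem toMultilinear_apply (T : Tensor d n) (x : Fin d → EuclideanSpace ℝ (Fin n)) :
    toMultilinear T x = innerT T (rankOne x) := by
  simp [toMultilinear, innerT, rankOne]

theorem innerT_comp_perm_rankOne (σ : Equiv.Perm (Fin d)) (T : Tensor d n)
    (x : Fin d → EuclideanSpace ℝ (Fin n)) :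
    innerT (fun i => T (i ∘ σ)) (rankOne x) = innerT T (rankOne (x ∘ σ)) := by
  rw [← innerT_comp_perm σ T]
  congr 1
  funext i
  exact (Equiv.prod_comp σ fun j => x j (i j)).symm

theorem toMultilinear_comp_perm {T : Tensor d n} (hT : IsSymm T) (σ : Equiv.Perm (Fin d))
    (x : Fin d → EuclideanSpace ℝ (Fin n)) :
    toMultilinear T (x ∘ σ) = toMultilinear T x := by
  rw [toMultilinear_apply, toMultilinear_apply, ← innerT_comp_perm_rankOne]
  simp only [hT σ]

theorem abs_innerT_rankOne_le (hn : 1 ≤ n) (T : Tensor d n)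
    {x : Fin d → EuclideanSpace ℝ (Fin n)} (hx : ∀ j, ‖x j‖ = 1) :
    |innerT T (rankOne x)| ≤ specNorm T :=
  (isGreatest_specNorm hn T).2 ⟨x, hx, rfl⟩

theorem abs_innerT_tpow_le (hn : 1 ≤ n) (T : Tensor d n)
    {x : EuclideanSpace ℝ (Fin n)} (hx : ‖x‖ = 1) : |innerT T (tpow d x)| ≤ specNorm T :=
  abs_innerT_rankOne_le hn T fun _ => hx

theorem specNorm_nonneg (hn : 1 ≤ n) (T : Tensor d n) : 0 ≤ specNorm T := by
  obtain ⟨x, -, h⟩ := (isGreatest_specNorm hn T).1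
  exact h ▸ abs_nonneg _

open Function in
theorem toMultilinear_update_swap {T : Tensor d n} (hT : IsSymm T) {a b : Fin d} (hab : a ≠ b)
    (x : Fin d → EuclideanSpace ℝ (Fin n)) (u v : EuclideanSpace ℝ (Fin n)) :
    toMultilinear T (update (update x a u) b v) = toMultilinear T (update (update x a v) b u) := by
  rw [← toMultilinear_comp_perm hT (Equiv.swap a b)]
  congr 1
  funext j
  simp only [comp_apply]
  by_cases hb : j = b
  · subst hb
    simp [hab]
  by_cases ha : j = a
  · subst ha
    simp [hab]
  · simp [Equiv.swap_apply_of_ne_of_ne ha hb, ha, hb]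

open Function in
-- With the other arguments frozen, the form is symmetric and bilinear in slots `a` and `b`, so the
-- ordinary polarization identity applies.
theorem toMultilinear_polarization {T : Tensor d n} (hT : IsSymm T) {a b : Fin d} (hab : a ≠ b)
    (x : Fin d → EuclideanSpace ℝ (Fin n)) (u v : EuclideanSpace ℝ (Fin n)) :
    toMultilinear T (update (update x a (u + v)) b (u + v))
      - toMultilinear T (update (update x a (u - v)) b (u - v))
      = 4 * toMultilinear T (update (update x a u) b v) := by
  have hl (u u' w : EuclideanSpace ℝ (Fin n)) :
      toMultilinear T (update (update x a (u + u')) b w)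
        = toMultilinear T (update (update x a u) b w)
          + toMultilinear T (update (update x a u') b w) := by
    rw [update_comm hab, update_comm hab, update_comm hab, MultilinearMap.map_update_add]
  have hl' (u u' w : EuclideanSpace ℝ (Fin n)) :
      toMultilinear T (update (update x a (u - u')) b w)
        = toMultilinear T (update (update x a u) b w)
          - toMultilinear T (update (update x a u') b w) := by
    rw [update_comm hab, update_comm hab, update_comm hab, MultilinearMap.map_update_sub]
  rw [hl, hl', MultilinearMap.map_update_add, MultilinearMap.map_update_add,
    MultilinearMap.map_update_sub, MultilinearMap.map_update_sub,
    toMultilinear_update_swap hT hab x v u]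
  ring

open Function in
theorem toMultilinear_update_smul_smul (T : Tensor d n) {a b : Fin d} (hab : a ≠ b)
    (x : Fin d → EuclideanSpace ℝ (Fin n)) (t : ℝ) (z : EuclideanSpace ℝ (Fin n)) :
    toMultilinear T (update (update x a (t • z)) b (t • z))
      = t ^ 2 * toMultilinear T (update (update x a z) b z) := by
  rw [MultilinearMap.map_update_smul, update_comm hab, MultilinearMap.map_update_smul,
    update_comm hab]
  simp only [smul_eq_mul]
  ring

open Function in
theorem norm_update_update_eq_one {x : Fin d → EuclideanSpace ℝ (Fin n)} (hx : ∀ j, ‖x j‖ = 1)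
    (a b : Fin d) {z : EuclideanSpace ℝ (Fin n)} (hz : ‖z‖ = 1) (j : Fin d) :
    ‖update (update x a z) b z j‖ = 1 := by
  by_cases hb : j = b
  · simp [hb, hz]
  by_cases ha : j = a
  · simp [ha, hz, update_apply]
  · simp [ha, hb, hx]

open Function in
theorem abs_toMultilinear_update_le (hn : 1 ≤ n) (T : Tensor d n) {a b : Fin d} (hab : a ≠ b)
    {x : Fin d → EuclideanSpace ℝ (Fin n)} (hx : ∀ j, ‖x j‖ = 1) (w : EuclideanSpace ℝ (Fin n)) :
    |toMultilinear T (update (update x a w) b w)| ≤ specNorm T * ‖w‖ ^ 2 := by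
  rcases eq_or_ne w 0 with rfl | hw
  · simp
  have hw' : ‖w‖ ≠ 0 := norm_ne_zero_iff.2 hw
  have hz : ‖(‖w‖⁻¹ • w)‖ = 1 := by simp [norm_smul, hw']
  have h := abs_innerT_rankOne_le hn T (norm_update_update_eq_one hx a b hz)
  have hs := toMultilinear_update_smul_smul T hab x ‖w‖ (‖w‖⁻¹ • w)
  rw [smul_inv_smul₀ hw'] at hs
  rw [hs, abs_mul, abs_of_nonneg (sq_nonneg _), mul_comm, toMultilinear_apply]
  gcongr

open Function in
/-- Two arguments of a maximum of a symmetric form can be replaced by their normalized sum. -/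
theorem exists_unit_abs_toMultilinear_update (hn : 1 ≤ n) {T : Tensor d n} (hT : IsSymm T)
    {a b : Fin d} (hab : a ≠ b) {x : Fin d → EuclideanSpace ℝ (Fin n)} (hx : ∀ j, ‖x j‖ = 1)
    (hmax : |toMultilinear T x| = specNorm T) :
    ∃ z : EuclideanSpace ℝ (Fin n), ‖z‖ = 1 ∧ x a + x b = ‖x a + x b‖ • z ∧
      |toMultilinear T (update (update x a z) b z)| = specNorm T := by
  have hB : toMultilinear T (update (update x a (x a)) b (x b)) = toMultilinear T x := by simp
  rcases eq_or_ne (x a + x b) 0 with h0 | h0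
  -- The sum has no direction here, but `x b = -x a`, so `x a` in both slots changes only the sign
  -- of the value.
  · refine ⟨x a, hx a, by simp [h0], ?_⟩
    have hxb : x b = -x a := (neg_eq_of_add_eq_zero_right h0).symm
    rw [← hmax, ← hB, hxb, ← neg_one_smul ℝ (x a), MultilinearMap.map_update_smul]
    simp
  have hu : ‖x a + x b‖ ≠ 0 := norm_ne_zero_iff.2 h0
  refine ⟨‖x a + x b‖⁻¹ • (x a + x b), by rw [norm_smul, norm_inv, norm_norm, inv_mul_cancel₀ hu], (smul_inv_smul₀ hu _).symm, ?_⟩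
  have hp := toMultilinear_polarization hT hab x (x a) (x b)
  rw [hB] at hp
  have h1 := abs_toMultilinear_update_le hn T hab hx (x a + x b)
  have h2 := abs_toMultilinear_update_le hn T hab hx (x a - x b)
  have hpar := parallelogram_law_with_norm ℝ (x a) (x b)
  rw [hx a, hx b] at hpar
  have h3 := abs_sub (toMultilinear T (update (update x a (x a + x b)) b (x a + x b)))
    (toMultilinear T (update (update x a (x a - x b)) b (x a - x b)))
  rw [hp, abs_mul, hmax, abs_of_pos (four_pos : (0 : ℝ) < 4)] at h3
  -- By polarization and the triangle inequality, `4 * specNorm T` is at most the sum of the two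
  -- absolute values bounded in `h1` and `h2`. By the parallelogram law those bounds add up to
  -- exactly `4 * specNorm T`, so both are equalities.
  have h4 : specNorm T * ‖x a + x b‖ ^ 2 + specNorm T * ‖x a - x b‖ ^ 2 = 4 * specNorm T := by
    linear_combination specNorm T * hpar
  rw [toMultilinear_update_smul_smul T hab, abs_mul, abs_of_nonneg (sq_nonneg _)]
  have h5 : |toMultilinear T (update (update x a (x a + x b)) b (x a + x b))|
      = specNorm T * ‖x a + x b‖ ^ 2 := by linarith
  rw [h5]
  field_simp

theorem sum_update_eq {ι E : Type*} [Fintype ι] [DecidableEq ι] [AddCommGroup E] (x : ι → E)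
    (a : ι) (u : E) : ∑ j, Function.update x a u j = ∑ j, x j - x a + u := by
  rw [← Finset.add_sum_erase _ _ (Finset.mem_univ a), ← Finset.add_sum_erase _ x (Finset.mem_univ a),
    Finset.sum_congr rfl fun j hj => Function.update_of_ne (Finset.ne_of_mem_erase hj) u x]
  simp
  abel

open Function in
/-- Banach's theorem: the spectral norm of a symmetric tensor is attained at a power `⊗^d x`. -/
theorem exists_specNorm_eq_abs_innerT_tpow (hn : 1 ≤ n) {T : Tensor d n} (hT : IsSymm T) :
    ∃ x : EuclideanSpace ℝ (Fin n), ‖x‖ = 1 ∧ specNorm T = |innerT T (tpow d x)| := by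
  have hcont : Continuous fun x : Fin d → EuclideanSpace ℝ (Fin n) => |toMultilinear T x| := by
    simp only [toMultilinear_apply, innerT, rankOne]
    fun_prop
  have hK : IsCompact ((Set.univ.pi fun _ : Fin d =>
      Metric.sphere (0 : EuclideanSpace ℝ (Fin n)) 1) ∩ {x | |toMultilinear T x| = specNorm T}) :=
    (isCompact_univ_pi fun _ => isCompact_sphere _ _).inter_right
      (isClosed_eq hcont continuous_const)
  obtain ⟨y, hy, hyT⟩ := (isGreatest_specNorm hn T).1
  -- Among the maximizing tuples of unit vectors, choose one whose sum is longest. It will turn out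
  -- to be constant.
  obtain ⟨x, ⟨hx, hxT⟩, hmax⟩ := hK.exists_isMaxOn
    ⟨y, by simpa using hy, by simp [toMultilinear_apply, hyT]⟩
    (f := fun x => ‖∑ j, x j‖ ^ 2) (by fun_prop)
  replace hx : ∀ j, ‖x j‖ = 1 := by simpa using hx
  have hxT' : |toMultilinear T x| = specNorm T := hxT
  have heq : ∀ a b, x a = x b := by
    by_contra! hne
    obtain ⟨a, b, hne⟩ := hne
    have hab : a ≠ b := fun h => hne (h ▸ rfl)
    obtain ⟨z, hz, hu, hzT⟩ := exists_unit_abs_toMultilinear_update hn hT hab hx hxT'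
    -- Strict convexity of the ball: distinct unit vectors have a sum shorter than 2.
    have hlt : ‖x a + x b‖ < 2 := by
      have hpar := parallelogram_law_with_norm ℝ (x a) (x b)
      rw [hx a, hx b] at hpar
      have : 0 < ‖x a - x b‖ := norm_pos_iff.2 (sub_ne_zero.2 hne)
      nlinarith [norm_nonneg (x a + x b)]
    -- Putting `ε • z` in both slots multiplies the form by `ε ^ 2 = 1`, so the new tuple is still
    -- maximizing and its sum cannot be longer.
    have key (ε : ℝ) (hε : |ε| = 1) :
        ‖∑ j, x j - (x a + x b) + (2 * ε) • z‖ ^ 2 ≤ ‖∑ j, x j‖ ^ 2 := by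
      have hz' : ‖ε • z‖ = 1 := by simp [norm_smul, hε, hz]
      have hmem := hmax (a := update (update x a (ε • z)) b (ε • z))
        ⟨by simpa using norm_update_update_eq_one hx a b hz', by
          simp [toMultilinear_update_smul_smul T hab, abs_mul, hε, hzT]⟩
      simp only [Set.mem_ofPred_eq, sum_update_eq, update_of_ne hab.symm] at hmem
      have hs : ∑ j, x j - (x a + x b) + (2 * ε) • z
          = ∑ j, x j - x a + ε • z - x b + ε • z := by
        rw [two_mul, add_smul]
        abel
      rwa [hs]
    set r := ∑ j, x j - (x a + x b) with hr
    have hsum : ∑ j, x j = r + ‖x a + x b‖ • z := by rw [← hu, hr]; abel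
    have hexp (t : ℝ) : ‖r + t • z‖ ^ 2 = ‖r‖ ^ 2 + 2 * t * inner ℝ r z + t ^ 2 := by
      rw [norm_add_sq_real, inner_smul_right, norm_smul, hz]
      simp
      ring
    have h1 := key 1 (by simp)
    have h2 := key (-1) (by simp)
    rw [hsum, hexp, hexp] at h1 h2
    have h0 := norm_nonneg (x a + x b)
    -- The old sum is `r + s • z` with `0 ≤ s < 2`, the new one `r + (2 * ε) • z`. If the sign `ε`
    -- agrees with that of `inner ℝ r z`, the new sum is strictly longer, a contradiction.
    rcases le_total 0 (inner ℝ r z) with h | h <;> nlinarith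
  -- For `d = 0` no entry of the tuple is available, and any unit vector serves.
  rcases isEmpty_or_nonempty (Fin d) with he | ⟨⟨j⟩⟩
  · refine ⟨EuclideanSpace.single (⟨0, hn⟩ : Fin n) (1 : ℝ), by simp, ?_⟩
    rw [← hxT', toMultilinear_apply, tpow, Subsingleton.elim x fun _ => _]
  · refine ⟨x j, hx j, ?_⟩
    rw [← hxT', toMultilinear_apply, tpow, show (fun _ => x j) = x from funext fun k => heq j k]

/-- By Banach's theorem the norm of `sym T` is attained at a power, where `T` and `sym T` take the
same value. -/
theorem specNorm_sym_le (hn : 1 ≤ n) (T : Tensor d n) : specNorm (sym T) ≤ specNorm T := by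
  obtain ⟨x, hx, h⟩ := exists_specNorm_eq_abs_innerT_tpow hn (isSymm_sym T)
  rw [h, innerT_sym_tpow]
  exact abs_innerT_tpow_le hn T hx

theorem specNorm_sym_eq_iff (hn : 1 ≤ n) (T : Tensor d n) :
    specNorm (sym T) = specNorm T ↔
      ∃ x : EuclideanSpace ℝ (Fin n), ‖x‖ = 1 ∧ specNorm T = |innerT T (tpow d x)| := by
  refine ⟨fun h => ?_, fun ⟨x, hx, h⟩ => (specNorm_sym_le hn T).antisymm ?_⟩
  · obtain ⟨x, hx, h'⟩ := exists_specNorm_eq_abs_innerT_tpow hn (isSymm_sym T)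
    exact ⟨x, hx, by rw [← h, h', innerT_sym_tpow]⟩
  · rw [h, ← innerT_sym_tpow]
    exact abs_innerT_tpow_le hn _ hx

end SymTensor

namespace SymTensor

variable {d p q n : ℕ}

/-! Tensors and polynomials. -/

theorem eq_of_eval_eq {f g : MvPolynomial (Fin n) ℝ}
    (h : ∀ x : EuclideanSpace ℝ (Fin n),
      MvPolynomial.eval (fun k => x k) f = MvPolynomial.eval (fun k => x k) g) : f = g :=
  MvPolynomial.funext fun y => h (WithLp.toLp 2 y)

theorem tensorOf_form_eq_sym (T : Tensor d n) : tensorOf d (form T) = sym T := by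
  have h : form T = form (sym T) := eq_of_eval_eq fun x => by
    rw [eval_form, eval_form, innerT_sym_tpow]
  rw [h, tensorOf_form (isSymm_sym T)]

/-! ### Tensor products and the equality case of the Hilbert-Schmidt inequality -/

theorem innerT_kron (A A' : Tensor p n) (B B' : Tensor q n) :
    innerT (kron A B) (kron A' B') = innerT A A' * innerT B B' := by
  rw [innerT, innerT, innerT, Fintype.sum_mul_sum, ← Fintype.sum_prod_type',
    ← (Fin.appendEquiv p q (α := Fin n)).sum_comp]
  refine Finset.sum_congr rfl fun i _ => ?_
  simp [kron, Fin.appendEquiv]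
  ring

theorem kron_tpow (x : EuclideanSpace ℝ (Fin n)) :
    kron (tpow p x) (tpow q x) = tpow (p + q) x := by
  funext i
  simp [kron, tpow, rankOne, Fin.prod_univ_add]

theorem kron_smul_smul (a b : ℝ) (A : Tensor p n) (B : Tensor q n) :
    kron (a • A) (b • B) = (a * b) • kron A B := by
  funext i
  simp [kron]
  ring

theorem form_kron (A : Tensor p n) (B : Tensor q n) : form (kron A B) = form A * form B :=
  eq_of_eval_eq fun x => by
    rw [map_mul, eval_form, eval_form, eval_form, ← kron_tpow, innerT_kron]

theorem symProd_eq_sym_kron (F : Tensor p n) (G : Tensor q n) :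
    symProd F G = sym (kron F G) := by
  rw [symProd, ← form_kron, tensorOf_form_eq_sym]

theorem hsNorm_kron (A : Tensor p n) (B : Tensor q n) :
    hsNorm (kron A B) = hsNorm A * hsNorm B := by
  rw [hsNorm, innerT_kron, Real.sqrt_mul (innerT_self_nonneg A), hsNorm, hsNorm]

theorem hsNorm_symProd_le (F : Tensor p n) (G : Tensor q n) :
    hsNorm (symProd F G) ≤ hsNorm F * hsNorm G := by
  rw [symProd_eq_sym_kron, ← hsNorm_kron]
  exact hsNorm_sym_le _

/-- Since `‖F‖ ‖G‖` is the norm of `kron F G`, this is the equality case of the projection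
inequality. -/
theorem hsNorm_symProd_eq_iff_isSymm (F : Tensor p n) (G : Tensor q n) :
    hsNorm (symProd F G) = hsNorm F * hsNorm G ↔ IsSymm (kron F G) := by
  rw [symProd_eq_sym_kron, ← hsNorm_kron, hsNorm_sym_eq_iff, sym_eq_self_iff]

/-- A tensor whose slices in every direction are parallel to `c` is a multiple of `⊗^d c`. -/
theorem eq_smul_tpow_of_parallel {T : Tensor d n} {c : EuclideanSpace ℝ (Fin n)} {l : Fin n}
    (hc : c l ≠ 0)
    (h : ∀ (i : Fin d → Fin n) (s : Fin d), T i * c l = T (Function.update i s l) * c (i s)) :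
    T = (T (fun _ => l) / c l ^ d) • tpow d c := by
  -- Indices at the positions in `A` are replaced by `l` one at a time, each replacement trading a
  -- factor `c l` for `c (i s)`. The case of all positions is the claim.
  have key (i : Fin d → Fin n) (A : Finset (Fin d)) :
      T i * c l ^ A.card = T (fun s => if s ∈ A then l else i s) * ∏ s ∈ A, c (i s) := by
    induction A using Finset.induction_on with
    | empty => simp
    | insert s A hs ih =>
      have h1 := h (fun t => if t ∈ A then l else i t) s
      have h2 : Function.update (fun t => if t ∈ A then l else i t) s l
          = fun t => if t ∈ insert s A then l else i t := by
        funext t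
        by_cases hts : t = s
        · simp [hts]
        · simp [hts]
      rw [h2] at h1
      simp only [hs, if_false] at h1
      rw [Finset.card_insert_of_notMem hs, Finset.prod_insert hs, pow_succ, ← mul_assoc, ih,
        ← mul_assoc, ← h1]
      ring
  funext i
  have h1 := key i Finset.univ
  simp only [Finset.mem_univ, if_true, Finset.card_univ, Fintype.card_fin] at h1
  simp only [Pi.smul_apply, smul_eq_mul, tpow, rankOne]
  field_simp
  exact h1

/-- Exchanging an index of `A` with an index of `B` in a symmetric `A ⊗ B`. -/
theorem IsSymm.kron_exchange {A : Tensor p n} {B : Tensor q n} (h : IsSymm (kron A B))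
    (i : Fin p → Fin n) (j : Fin q → Fin n) (s : Fin p) (t : Fin q) :
    A (Function.update i s (j t)) * B (Function.update j t (i s)) = A i * B j := by
  have h1 := h (Equiv.swap (Fin.castAdd q s) (Fin.natAdd p t)) (Fin.append i j)
  have hA : (fun k => (Fin.append i j ∘ Equiv.swap (Fin.castAdd q s) (Fin.natAdd p t))
      (Fin.castAdd q k)) = Function.update i s (j t) := by
    funext k
    by_cases hk : k = s
    · simp [hk]
    · have h2 : Fin.castAdd q k ≠ Fin.natAdd p t := fun e => by
        have := congrArg Fin.val e
        simp at this
        omega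
      have h3 : Fin.castAdd q k ≠ Fin.castAdd q s := by simpa using hk
      simp [Equiv.swap_apply_of_ne_of_ne h3 h2, hk]
  have hB : (fun k => (Fin.append i j ∘ Equiv.swap (Fin.castAdd q s) (Fin.natAdd p t))
      (Fin.natAdd p k)) = Function.update j t (i s) := by
    funext k
    by_cases hk : k = t
    · simp [hk]
    · have h2 : Fin.natAdd p k ≠ Fin.castAdd q s := fun e => by
        have := congrArg Fin.val e
        simp at this
        omega
      have h3 : Fin.natAdd p k ≠ Fin.natAdd p t := by simpa using hk
      simp [Equiv.swap_apply_of_ne_of_ne h2 h3, hk]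
  simp only [kron, hA, hB] at h1
  simpa using h1

/-- The vector `c` is a slice of `F` through a nonzero entry. Exchanging indices with this slice
makes every slice of `G` parallel to `c`, so `G` is a multiple of a power of `c`. Exchanging indices
with a nonzero slice of that power makes the slices of `F` parallel to `c` as well. -/
theorem IsSymm.exists_eq_smul_tpow (hp : 1 ≤ p) (hq : 1 ≤ q) {F : Tensor p n} {G : Tensor q n}
    (h : IsSymm (kron F G)) (hF : F ≠ 0) (hG : G ≠ 0) :
    ∃ (c : EuclideanSpace ℝ (Fin n)) (a b : ℝ), c ≠ 0 ∧ a ≠ 0 ∧ b ≠ 0 ∧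
      F = a • tpow p c ∧ G = b • tpow q c := by
  obtain ⟨i, hi⟩ := Function.ne_iff.1 hF
  set s : Fin p := ⟨0, hp⟩
  set t : Fin q := ⟨0, hq⟩
  set c : EuclideanSpace ℝ (Fin n) := WithLp.toLp 2 fun k => F (Function.update i s k) with hcdef
  have hck (k : Fin n) : c k = F (Function.update i s k) := rfl
  have hc : c (i s) ≠ 0 := by simpa [hck] using hi
  have hG' := eq_smul_tpow_of_parallel (T := G) hc fun j t' => by
    have := h.kron_exchange i j s t'
    rw [hck, hck, Function.update_eq_self]
    linarith
  obtain ⟨b, hb⟩ : ∃ b : ℝ, G = b • tpow q c := ⟨_, hG'⟩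
  have hb0 : b ≠ 0 := by
    rintro rfl
    exact hG (by simpa using hb)
  have hF' := eq_smul_tpow_of_parallel (T := F) hc fun i' s' => by
    have := h.kron_exchange i' (fun _ => i s) s' t
    -- One of the `q` indices is `k` and the other `q - 1` are `i s`. The common factor `b * c (i s)
    -- ^ (q - 1)` is nonzero and is cancelled below.
    have hGk (k : Fin n) : G (Function.update (fun _ => i s) t k)
        = b * (c k * c (i s) ^ (q - 1)) := by
      rw [hb]
      simp only [Pi.smul_apply, smul_eq_mul, tpow, rankOne]
      rw [← Finset.mul_prod_erase _ _ (Finset.mem_univ t),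
        Finset.prod_congr rfl fun j hj => by
          rw [Function.update_of_ne (Finset.ne_of_mem_erase hj)]]
      simp
    have h0 := hGk (i s)
    rw [Function.update_eq_self] at h0
    rw [hGk, h0] at this
    have hne : b * c (i s) ^ (q - 1) ≠ 0 := mul_ne_zero hb0 (pow_ne_zero _ hc)
    refine mul_left_cancel₀ hne ?_
    linear_combination -this
  obtain ⟨a, ha⟩ : ∃ a : ℝ, F = a • tpow p c := ⟨_, hF'⟩
  refine ⟨c, a, b, fun h0 => hc (by rw [h0]; rfl), ?_, hb0, ha, hb⟩
  rintro rfl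
  exact hF (by simpa using ha)

theorem hsNorm_symProd_eq_iff (hp : 1 ≤ p) (hq : 1 ≤ q) (F : Tensor p n) (G : Tensor q n) :
    hsNorm (symProd F G) = hsNorm F * hsNorm G ↔
      F = 0 ∨ G = 0 ∨ ∃ (c : EuclideanSpace ℝ (Fin n)) (a b : ℝ), c ≠ 0 ∧ a ≠ 0 ∧ b ≠ 0 ∧
        F = a • tpow p c ∧ G = b • tpow q c := by
  rw [hsNorm_symProd_eq_iff_isSymm]
  constructor
  · intro h
    by_cases hF : F = 0
    · exact Or.inl hF
    by_cases hG : G = 0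
    · exact Or.inr (Or.inl hG)
    exact Or.inr (Or.inr (h.exists_eq_smul_tpow hp hq hF hG))
  · rintro (rfl | rfl | ⟨c, a, b, -, -, -, rfl, rfl⟩)
    · intro σ i
      simp [kron]
    · intro σ i
      simp [kron]
    · rw [kron_smul_smul, kron_tpow]
      exact (isSymm_tpow c).smul _

/-! ### Powers of linear forms and Cauchy-Schwarz -/

theorem innerT_tpow_tpow (c x : EuclideanSpace ℝ (Fin n)) :
    innerT (tpow p c) (tpow p x) = (inner ℝ c x) ^ p := by
  simp only [innerT, tpow, rankOne, ← Finset.prod_mul_distrib]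
  rw [← Fintype.sum_pow (fun k => c k * x k) p, PiLp.inner_apply]
  simp [mul_comm]

theorem hsNorm_tpow (c : EuclideanSpace ℝ (Fin n)) : hsNorm (tpow p c) = ‖c‖ ^ p := by
  rw [hsNorm, innerT_tpow_tpow, real_inner_self_eq_norm_sq, ← pow_mul, mul_comm, pow_mul,
    Real.sqrt_sq (by positivity)]

theorem tensorOf_eq_zero_iff {f : MvPolynomial (Fin n) ℝ} (hf : f.IsHomogeneous p) :
    tensorOf p f = 0 ↔ f = 0 := by
  refine ⟨fun h => ?_, fun h => ?_⟩
  · rw [← form_tensorOf hf, h]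
    simp [form]
  · funext i
    simp [tensorOf, h]

theorem tensorOf_eq_smul_tpow_iff {f : MvPolynomial (Fin n) ℝ} (hf : f.IsHomogeneous p)
    (a : ℝ) (c : EuclideanSpace ℝ (Fin n)) :
    tensorOf p f = a • tpow p c ↔ ∀ x : EuclideanSpace ℝ (Fin n),
      MvPolynomial.eval (fun k => x k) f = a * (inner ℝ c x) ^ p := by
  constructor
  · intro h x
    rw [← form_tensorOf hf, eval_form, h, innerT_smul_left, innerT_tpow_tpow]
  · intro h
    have : f = form (a • tpow p c) := eq_of_eval_eq fun x => by
      rw [h, eval_form, innerT_smul_left, innerT_tpow_tpow]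
    rw [this, tensorOf_form ((isSymm_tpow c).smul a)]

/-- The tensor `R = ⟨T,T⟩ S - ⟨S,T⟩ T` is orthogonal to `T`. Equality in Cauchy-Schwarz says `⟨R,S⟩
= 0`, so the identity gives `R = 0`, which makes `S` a multiple of a nonzero `T`. -/
theorem innerT_sub_proj (S T : Tensor d n) :
    innerT T T * innerT (innerT T T • S - innerT S T • T) S
      = innerT (innerT T T • S - innerT S T • T) (innerT T T • S - innerT S T • T) := by
  simp only [innerT_sub_left, innerT_sub_right, innerT_smul_left, innerT_smul_right,
    innerT_comm T S]
  ring

theorem abs_innerT_le (S T : Tensor d n) : |innerT S T| ≤ hsNorm S * hsNorm T := by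
  refine abs_le_of_sq_le_sq ?_ (mul_nonneg (hsNorm_nonneg S) (hsNorm_nonneg T))
  rw [mul_pow, hsNorm_sq, hsNorm_sq, innerT, innerT, innerT]
  simpa only [sq] using Finset.sum_mul_sq_le_sq_mul_sq Finset.univ S T

theorem abs_innerT_eq_iff (S : Tensor d n) {T : Tensor d n} (hT : T ≠ 0) :
    |innerT S T| = hsNorm S * hsNorm T ↔ ∃ a : ℝ, S = a • T := by
  constructor
  · intro h
    have h2 : innerT S T ^ 2 = innerT S S * innerT T T := by
      rw [← sq_abs, h, mul_pow, hsNorm_sq, hsNorm_sq]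
    have hT' : innerT T T ≠ 0 := fun h => hT (innerT_self_eq_zero.1 h)
    have h3 := innerT_sub_proj S T
    have h4 : innerT (innerT T T • S - innerT S T • T) S = 0 := by
      simp only [innerT_sub_left, innerT_smul_left, innerT_comm T S]
      linear_combination -h2
    rw [h4, mul_zero] at h3
    have h5 := sub_eq_zero.1 (innerT_self_eq_zero.1 h3.symm)
    exact ⟨(innerT T T)⁻¹ * innerT S T, by rw [mul_smul, ← h5, inv_smul_smul₀ hT']⟩
  · rintro ⟨a, rfl⟩
    rw [innerT_smul_left, abs_mul, hsNorm_smul, abs_of_nonneg (innerT_self_nonneg T), ← hsNorm_sq]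
    ring

theorem eval_eq_innerT_tensorOf {f : MvPolynomial (Fin n) ℝ} (hf : f.IsHomogeneous p)
    (x : EuclideanSpace ℝ (Fin n)) :
    MvPolynomial.eval (fun k => x k) f = innerT (tensorOf p f) (tpow p x) := by
  rw [← eval_form, form_tensorOf hf]

theorem abs_eval_le_polyHS {f : MvPolynomial (Fin n) ℝ} (hf : f.IsHomogeneous p)
    (c : EuclideanSpace ℝ (Fin n)) :
    |MvPolynomial.eval (fun k => c k) f| ≤ polyHS p f * ‖c‖ ^ p := by
  rw [eval_eq_innerT_tensorOf hf, ← hsNorm_tpow]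
  exact abs_innerT_le _ _

theorem abs_eval_eq_polyHS_iff {f : MvPolynomial (Fin n) ℝ} (hf : f.IsHomogeneous p)
    {c : EuclideanSpace ℝ (Fin n)} (hc : c ≠ 0) :
    |MvPolynomial.eval (fun k => c k) f| = polyHS p f * ‖c‖ ^ p ↔
      ∃ a : ℝ, ∀ x : EuclideanSpace ℝ (Fin n),
        MvPolynomial.eval (fun k => x k) f = a * (inner ℝ c x) ^ p := by
  have h0 : tpow p c ≠ 0 := fun h => by
    have h1 := hsNorm_tpow (p := p) c
    rw [h, hsNorm_zero] at h1
    exact pow_ne_zero p (norm_ne_zero_iff.2 hc) h1.symm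
  rw [eval_eq_innerT_tensorOf hf, ← hsNorm_tpow, polyHS, abs_innerT_eq_iff _ h0]
  exact exists_congr fun a => tensorOf_eq_smul_tpow_iff hf a c

/-! ### Norms of products and powers of polynomials -/

theorem tensorOf_mul {f g : MvPolynomial (Fin n) ℝ} (hf : f.IsHomogeneous p)
    (hg : g.IsHomogeneous q) :
    tensorOf (p + q) (f * g) = symProd (tensorOf p f) (tensorOf q g) := by
  rw [symProd, form_tensorOf hf, form_tensorOf hg]

theorem abs_eval_le_polySpec (hn : 1 ≤ n) {f : MvPolynomial (Fin n) ℝ} (hf : f.IsHomogeneous p)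
    {x : EuclideanSpace ℝ (Fin n)} (hx : ‖x‖ = 1) :
    |MvPolynomial.eval (fun k => x k) f| ≤ polySpec p f := by
  rw [eval_eq_innerT_tensorOf hf]
  exact abs_innerT_tpow_le hn _ hx

theorem exists_polySpec_eq_abs_eval (hn : 1 ≤ n) {f : MvPolynomial (Fin n) ℝ}
    (hf : f.IsHomogeneous p) :
    ∃ x : EuclideanSpace ℝ (Fin n), ‖x‖ = 1 ∧
      polySpec p f = |MvPolynomial.eval (fun k => x k) f| := by
  simp only [eval_eq_innerT_tensorOf hf]
  exact exists_specNorm_eq_abs_innerT_tpow hn (isSymm_tensorOf p f)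

theorem polySpec_mul_le (hn : 1 ≤ n) {f g : MvPolynomial (Fin n) ℝ} (hf : f.IsHomogeneous p)
    (hg : g.IsHomogeneous q) : polySpec (p + q) (f * g) ≤ polySpec p f * polySpec q g := by
  obtain ⟨x, hx, h⟩ := exists_polySpec_eq_abs_eval hn (hf.mul hg)
  rw [h, map_mul, abs_mul]
  exact mul_le_mul (abs_eval_le_polySpec hn hf hx) (abs_eval_le_polySpec hn hg hx)
    (abs_nonneg _) (specNorm_nonneg hn _)

theorem polySpec_mul_eq_iff (hn : 1 ≤ n) {f g : MvPolynomial (Fin n) ℝ} (hf : f.IsHomogeneous p)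
    (hg : g.IsHomogeneous q) :
    polySpec (p + q) (f * g) = polySpec p f * polySpec q g ↔
      ∃ x : EuclideanSpace ℝ (Fin n), ‖x‖ = 1 ∧
        polySpec p f = |MvPolynomial.eval (fun k => x k) f| ∧
        polySpec q g = |MvPolynomial.eval (fun k => x k) g| := by
  constructor
  · intro h
    have hf0 : 0 ≤ polySpec p f := specNorm_nonneg hn _
    have hg0 : 0 ≤ polySpec q g := specNorm_nonneg hn _
    -- If one norm is zero, that polynomial vanishes on the sphere, and any maximizer of the other
    -- one serves both.
    rcases hf0.eq_or_lt' with hf1 | hf1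
    · obtain ⟨x, hx, hxg⟩ := exists_polySpec_eq_abs_eval hn hg
      exact ⟨x, hx, le_antisymm (hf1 ▸ abs_nonneg _) (abs_eval_le_polySpec hn hf hx), hxg⟩
    rcases hg0.eq_or_lt' with hg1 | hg1
    · obtain ⟨x, hx, hxf⟩ := exists_polySpec_eq_abs_eval hn hf
      exact ⟨x, hx, hxf, le_antisymm (hg1 ▸ abs_nonneg _) (abs_eval_le_polySpec hn hg hx)⟩
    obtain ⟨x, hx, hfg⟩ := exists_polySpec_eq_abs_eval hn (hf.mul hg)
    rw [map_mul, abs_mul, h] at hfg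
    have h1 := abs_eval_le_polySpec hn hf hx
    have h2 := abs_eval_le_polySpec hn hg hx
    -- At a maximizer of `|f g|`, a factor strictly below its norm would make the product strictly
    -- smaller, since the other norm is positive.
    refine ⟨x, hx, le_antisymm (not_lt.1 fun hlt => ?_) h1,
      le_antisymm (not_lt.1 fun hlt => ?_) h2⟩
    · exact hfg.not_gt ((mul_le_mul_of_nonneg_left h2 (abs_nonneg _)).trans_lt
        (mul_lt_mul_of_pos_right hlt hg1))
    · exact hfg.not_gt ((mul_le_mul_of_nonneg_right h1 (abs_nonneg _)).trans_lt
        (mul_lt_mul_of_pos_left hlt hf1))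
  · rintro ⟨x, hx, h1, h2⟩
    refine (polySpec_mul_le hn hf hg).antisymm ?_
    rw [h1, h2, ← abs_mul, ← map_mul]
    exact abs_eval_le_polySpec hn (hf.mul hg) hx

/-- Both sides are maxima over the sphere, and `|f ^ k| = |f| ^ k` pointwise. -/
theorem polySpec_pow (hn : 1 ≤ n) {f : MvPolynomial (Fin n) ℝ} (hf : f.IsHomogeneous p) (k : ℕ) :
    polySpec (k * p) (f ^ k) = polySpec p f ^ k := by
  have hk : (f ^ k).IsHomogeneous (k * p) := mul_comm p k ▸ hf.pow k
  apply le_antisymm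
  · obtain ⟨x, hx, h⟩ := exists_polySpec_eq_abs_eval hn hk
    rw [h, map_pow, abs_pow]
    exact pow_le_pow_left₀ (abs_nonneg _) (abs_eval_le_polySpec hn hf hx) k
  · obtain ⟨x, hx, h⟩ := exists_polySpec_eq_abs_eval hn hf
    rw [h, ← abs_pow, ← map_pow]
    exact abs_eval_le_polySpec hn hk hx

theorem polyHS_mul_eq_iff (hp : 1 ≤ p) (hq : 1 ≤ q) {f g : MvPolynomial (Fin n) ℝ}
    (hf : f.IsHomogeneous p) (hg : g.IsHomogeneous q) :
    polyHS (p + q) (f * g) = polyHS p f * polyHS q g ↔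
      f = 0 ∨ g = 0 ∨
        ∃ (c : EuclideanSpace ℝ (Fin n)) (a b : ℝ), c ≠ 0 ∧ a ≠ 0 ∧ b ≠ 0 ∧
          (∀ x : EuclideanSpace ℝ (Fin n),
            MvPolynomial.eval (fun k => x k) f = a * (inner ℝ c x) ^ p) ∧
          (∀ x : EuclideanSpace ℝ (Fin n),
            MvPolynomial.eval (fun k => x k) g = b * (inner ℝ c x) ^ q) := by
  simp only [polyHS, tensorOf_mul hf hg, hsNorm_symProd_eq_iff hp hq, tensorOf_eq_zero_iff hf,
    tensorOf_eq_zero_iff hg, tensorOf_eq_smul_tpow_iff hf, tensorOf_eq_smul_tpow_iff hg]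

end SymTensor
theorem lemma2p1 {n d p q : ℕ} (hn : 1 ≤ n) (T : Tensor d n) (F : Tensor p n) (G : Tensor q n)
    (hF : IsSymm F) (hG : IsSymm G) :
    -- (a)
    (hsNorm (sym T) ≤ hsNorm T ∧ (hsNorm (sym T) = hsNorm T ↔ sym T = T)) ∧
    -- (b)
    (∀ x : EuclideanSpace ℝ (Fin n), innerT T (tpow d x) = innerT (sym T) (tpow d x)) ∧
    -- (c)
    (specNorm (sym T) ≤ specNorm T ∧
      (specNorm (sym T) = specNorm T ↔
        ∃ x : EuclideanSpace ℝ (Fin n), ‖x‖ = 1 ∧ specNorm T = |innerT T (tpow d x)|)) ∧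
    -- (d)
    symProd F G = sym (kron F G) ∧
    -- (e)
    (hsNorm (symProd F G) ≤ hsNorm F * hsNorm G ∧
      (1 ≤ p → 1 ≤ q →
        (hsNorm (symProd F G) = hsNorm F * hsNorm G ↔
          F = 0 ∨ G = 0 ∨
            ∃ (c : EuclideanSpace ℝ (Fin n)) (a b : ℝ), c ≠ 0 ∧ a ≠ 0 ∧ b ≠ 0 ∧
              F = a • tpow p c ∧ G = b • tpow q c))) ∧
    -- (f)
    (∀ f g : MvPolynomial (Fin n) ℝ, f.IsHomogeneous p → g.IsHomogeneous q →
      -- (i)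
      (∀ c : EuclideanSpace ℝ (Fin n),
        |MvPolynomial.eval (fun k => c k) f| ≤ polyHS p f * ‖c‖ ^ p ∧
        (c ≠ 0 →
          (|MvPolynomial.eval (fun k => c k) f| = polyHS p f * ‖c‖ ^ p ↔
            ∃ a : ℝ, ∀ x : EuclideanSpace ℝ (Fin n),
              MvPolynomial.eval (fun k => x k) f = a * (inner ℝ c x) ^ p))) ∧
      -- (ii)
      (polyHS (p + q) (f * g) ≤ polyHS p f * polyHS q g ∧
        (1 ≤ p → 1 ≤ q →
          (polyHS (p + q) (f * g) = polyHS p f * polyHS q g ↔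
            f = 0 ∨ g = 0 ∨
              ∃ (c : EuclideanSpace ℝ (Fin n)) (a b : ℝ), c ≠ 0 ∧ a ≠ 0 ∧ b ≠ 0 ∧
                (∀ x : EuclideanSpace ℝ (Fin n),
                  MvPolynomial.eval (fun k => x k) f = a * (inner ℝ c x) ^ p) ∧
                (∀ x : EuclideanSpace ℝ (Fin n),
                  MvPolynomial.eval (fun k => x k) g = b * (inner ℝ c x) ^ q)))) ∧
      -- (iii)
      (polySpec (p + q) (f * g) ≤ polySpec p f * polySpec q g ∧
        (polySpec (p + q) (f * g) = polySpec p f * polySpec q g ↔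
          ∃ x : EuclideanSpace ℝ (Fin n), ‖x‖ = 1 ∧
            polySpec p f = |MvPolynomial.eval (fun k => x k) f| ∧
            polySpec q g = |MvPolynomial.eval (fun k => x k) g|)) ∧
      -- (iv)
      (∀ k : ℕ, 1 ≤ k → polySpec (k * p) (f ^ k) = polySpec p f ^ k)) := by
  refine ⟨⟨hsNorm_sym_le T, hsNorm_sym_eq_iff T⟩, fun x => (innerT_sym_tpow T x).symm,
    ⟨specNorm_sym_le hn T, specNorm_sym_eq_iff hn T⟩, symProd_eq_sym_kron F G,
    ⟨hsNorm_symProd_le F G, fun hp hq => hsNorm_symProd_eq_iff hp hq F G⟩,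
    fun f g hf hg => ⟨fun c => ⟨abs_eval_le_polyHS hf c, abs_eval_eq_polyHS_iff hf⟩,
      ⟨?_, fun hp hq => polyHS_mul_eq_iff hp hq hf hg⟩,
      ⟨polySpec_mul_le hn hf hg, polySpec_mul_eq_iff hn hf hg⟩,
      fun k _ => polySpec_pow hn hf k⟩⟩
  rw [polyHS, tensorOf_mul hf hg]
  exact hsNorm_symProd_le _ _
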